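/- All Hilbert spaces are finite-dimensional and non-zero. A density matrix is a positive semidefinite complex matrix of trace $1$; a channel is a completely positive, trace-preserving linear map between complex matrix algebras. For a density matrix $\rho$ let $S(\rho) = -\operatorname{Tr}(\rho \log \rho)$ be its von Neumann entropy, and for a channel $\Omega$ let $$S_{\min}(\Omega) = \inf_{\rho} S(\Omega(\rho))$$ be its minimal output entropy, where the infimum runs over all density matrices $\rho$ in the domain of $\Omega$. A channel $\Phi$ is called entanglement-breaking if it has the form $$\Phi(\rho) = \sum_{k=1}^K R_k \operatorname{Tr}(X_k \rho),$$ where each $R_k$ is a density matrix and $\{X_k\}_{k=1}^K$ is a POVM, that is, $X_k \ge 0$ for all $k$ and $\sum_k X_k = I$. Theorem. Let $\Phi$ be an entanglement-breaking channel and let $\Omega$ be an arbitrary channel. Then $$S_{\min}(\Phi \otimes \Omega) = S_{\min}(\Phi) + S_{\min}(\Omega).$$ -/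

import Mathlib

open scoped ComplexOrder Kronecker

namespace QChan

/-- A density matrix (state): positive semidefinite with trace one. -/
structure IsDensityMatrix {n : Type*} [Fintype n] (ρ : Matrix n n ℂ) : Prop where
  posSemidef : ρ.PosSemidef
  trace_eq_one : ρ.trace = 1

/-- The tensor product `Φ ⊗ Ω` of two linear maps between matrix algebras: the linear extension of
`A ⊗ B ↦ Φ A ⊗ Ω B`, written out on the matrix units (see `tensorMap_kronecker`). -/
noncomputable def tensorMap {a b c d : Type*} [Fintype a] [DecidableEq a] [Fintype c]
    [DecidableEq c]
    (Φ : Matrix a a ℂ →ₗ[ℂ] Matrix b b ℂ) (Ω : Matrix c c ℂ →ₗ[ℂ] Matrix d d ℂ) :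
    Matrix (a × c) (a × c) ℂ →ₗ[ℂ] Matrix (b × d) (b × d) ℂ where
  toFun M := ∑ x : a × c, ∑ y : a × c,
    M x y • (Φ (Matrix.single x.1 y.1 1) ⊗ₖ Ω (Matrix.single x.2 y.2 1))
  map_add' M N := by simp [add_smul, Finset.sum_add_distrib]
  map_smul' r M := by simp [mul_smul, Finset.smul_sum]

/-- `Φ ⊗ Ω` sends `A ⊗ B` to `Φ A ⊗ Ω B`. -/
theorem tensorMap_kronecker {a b c d : Type*} [Fintype a] [DecidableEq a] [Fintype c]
    [DecidableEq c]
    (Φ : Matrix a a ℂ →ₗ[ℂ] Matrix b b ℂ) (Ω : Matrix c c ℂ →ₗ[ℂ] Matrix d d ℂ)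
    (A : Matrix a a ℂ) (B : Matrix c c ℂ) :
    tensorMap Φ Ω (A ⊗ₖ B) = Φ A ⊗ₖ Ω B := by
  have hA : Φ A = ∑ i, ∑ j, A i j • Φ (Matrix.single i j 1) := by
    conv_lhs => rw [Matrix.matrix_eq_sum_single A]
    simp only [map_sum, ← map_smul, Matrix.smul_single, smul_eq_mul, mul_one]
  have hB : Ω B = ∑ i, ∑ j, B i j • Ω (Matrix.single i j 1) := by
    conv_lhs => rw [Matrix.matrix_eq_sum_single B]
    simp only [map_sum, ← map_smul, Matrix.smul_single, smul_eq_mul, mul_one]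
  rw [hA, hB]
  ext ⟨p, q⟩ ⟨p', q'⟩
  simp only [tensorMap, LinearMap.coe_mk, AddHom.coe_mk, Matrix.sum_apply, Matrix.smul_apply,
    Matrix.kroneckerMap_apply, smul_eq_mul, Fintype.sum_prod_type, Finset.sum_mul_sum]
  refine Finset.sum_congr rfl fun i _ => Finset.sum_congr rfl fun k _ => ?_
  refine Finset.sum_congr rfl fun j _ => Finset.sum_congr rfl fun l _ => ?_
  ring

/-- Complete positivity: every ampliation `I_n ⊗ Φ` preserves positive semidefiniteness. -/
def IsCompletelyPositive {a b : Type*} [Fintype a] [DecidableEq a]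
    (Φ : Matrix a a ℂ →ₗ[ℂ] Matrix b b ℂ) : Prop :=
  ∀ (n : ℕ) (M : Matrix (Fin n × a) (Fin n × a) ℂ), M.PosSemidef →
    (tensorMap (LinearMap.id : Matrix (Fin n) (Fin n) ℂ →ₗ[ℂ] Matrix (Fin n) (Fin n) ℂ)
      Φ M).PosSemidef

/-- A (quantum) channel: a completely positive, trace-preserving linear map. -/
structure IsChannel {a b : Type*} [Fintype a] [DecidableEq a] [Fintype b]
    (Φ : Matrix a a ℂ →ₗ[ℂ] Matrix b b ℂ) : Prop where
  completelyPositive : IsCompletelyPositive Φ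
  trace_map : ∀ A : Matrix a a ℂ, (Φ A).trace = A.trace

/-- An entanglement-breaking channel: a channel of the form `Φ(ρ) = ∑ₖ Rₖ Tr(Xₖ ρ)` with density
matrices `Rₖ` and a POVM `{Xₖ}`. (Such a map is automatically a channel.) -/
def IsEntanglementBreaking {a b : Type*} [Fintype a] [DecidableEq a] [Fintype b]
    (Φ : Matrix a a ℂ →ₗ[ℂ] Matrix b b ℂ) : Prop :=
  ∃ (K : ℕ) (R : Fin K → Matrix b b ℂ) (X : Fin K → Matrix a a ℂ),
    (∀ k, IsDensityMatrix (R k)) ∧ (∀ k, (X k).PosSemidef) ∧ ∑ k, X k = 1 ∧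
    ∀ ρ : Matrix a a ℂ, Φ ρ = ∑ k, (X k * ρ).trace • R k

/-- The von Neumann entropy `S(ρ) = -Tr(ρ log ρ)`, with `log` applied through the functional
calculus (the convention `0 log 0 = 0` holds because `Real.log 0 = 0`). -/
noncomputable def vonNeumannEntropy {n : Type*} [Fintype n] [DecidableEq n]
    (ρ : Matrix n n ℂ) : ℝ :=
  -(ρ * cfc Real.log ρ).trace.re

/-- The minimal output entropy `S_min(Ω) = inf_ρ S(Ω(ρ))` over all density matrices `ρ` in the
domain of `Ω`. -/
noncomputable def minEntropy {a b : Type*} [Fintype a] [Fintype b] [DecidableEq b]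
    (Ω : Matrix a a ℂ →ₗ[ℂ] Matrix b b ℂ) : ℝ :=
  sInf ((fun ρ : Matrix a a ℂ => vonNeumannEntropy (Ω ρ)) '' {ρ | IsDensityMatrix ρ})

end QChan

/-!
The relative entropy is the integral over `t > 0`, with weight `t / (1 + t) ^ 2`, of the quadratic
forms `⟨A - B, (L_A + t R_B)⁻¹ (A - B)⟩`, up to a term in the traces. Each such form is the maximum
over matrices `X` of a concave quadratic functional, and testing the functional of `A` and `B` with
`X ⊗ 1` gives the functional of their partial traces at `X`; so the relative entropy, and with it
the Holevo quantity of an ensemble, decreases under the partial trace. For the ensemble of product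
states `Rₖ ⊗ Tₖ` with probabilities `pₖ` this reads
`S(∑ pₖ Rₖ) + ∑ pₖ S(Tₖ) ≤ S(∑ pₖ Rₖ ⊗ Tₖ)`.

If `Φ` is entanglement-breaking, then `Φ ⊗ Ω` maps a state `ρ` to a mixture `∑ pₖ Rₖ ⊗ Ω(σₖ)` with
`∑ pₖ Rₖ = Φ(Tr₂ ρ)`, and the inequality bounds its entropy below by the sum of the two minimal
entropies. Product states give the opposite bound.
-/

namespace QChan

open Matrix MeasureTheory Set Filter Topology

section ScalarIntegral

/-- The value at eigenvalues `x` of `A` and `y` of `B` of the quadratic form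
`⟨A - B, (L_A + t R_B)⁻¹ (A - B)⟩`, where `L_A` and `R_B` denote left multiplication by `A` and
right multiplication by `B`. At `x = y = 0` it is `0`. -/
noncomputable def resolventKernel (t x y : ℝ) : ℝ :=
  (x - y) ^ 2 / (x + t * y)

/-- A primitive in `t` of `resolventKernel t x y * (t / (1 + t) ^ 2)`. -/
noncomputable def resolventPrimitive (x y t : ℝ) : ℝ :=
  x * (Real.log (1 + t) - Real.log (x + t * y)) + (x - y) / (1 + t)

variable {x y : ℝ}

theorem hasDerivAt_resolventPrimitive (hx : 0 ≤ x) (hy : 0 < y) {t : ℝ} (ht : 0 < t) :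
    HasDerivAt (resolventPrimitive x y) (resolventKernel t x y * (t / (1 + t) ^ 2)) t := by
  have h₁ : 1 + t ≠ 0 := by positivity
  have h₂ : x + t * y ≠ 0 := by positivity
  have d₁ : HasDerivAt (fun t : ℝ => 1 + t) 1 t := (hasDerivAt_id t).const_add 1
  have d₂ : HasDerivAt (fun t : ℝ => x + t * y) y t := by
    simpa using ((hasDerivAt_id t).mul_const y).const_add x
  refine ((((d₁.log h₁).sub (d₂.log h₂)).const_mul x).add
    ((hasDerivAt_const t (x - y)).div d₁ h₁)).congr_deriv ?_
  rw [resolventKernel]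
  field_simp
  ring

theorem continuousAt_resolventPrimitive_zero (x y : ℝ) :
    ContinuousAt (resolventPrimitive x y) 0 := by
  have h_frac : ContinuousAt (fun t : ℝ => (x - y) / (1 + t)) 0 :=
    ContinuousAt.div (by fun_prop) (by fun_prop) (by norm_num)
  have h_log : ContinuousAt (fun t : ℝ => x * (Real.log (1 + t) - Real.log (x + t * y))) 0 := by
    rcases eq_or_ne x 0 with rfl | hx
    · simpa using continuousAt_const
    · exact continuousAt_const.mul <|
        (ContinuousAt.log (by fun_prop) (by norm_num)).sub
          (ContinuousAt.log (by fun_prop) (by simpa using hx))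
  exact h_log.add h_frac

theorem tendsto_resolventPrimitive_atTop (hx : 0 ≤ x) (hy : 0 < y) :
    Tendsto (resolventPrimitive x y) atTop (𝓝 (-(x * Real.log y))) := by
  have h_ratio : Tendsto (fun t : ℝ => (t⁻¹ + 1) / (x * t⁻¹ + y)) atTop (𝓝 y⁻¹) := by
    have h : Tendsto (fun t : ℝ => (t⁻¹ + 1) / (x * t⁻¹ + y)) atTop
        (𝓝 ((0 + 1) / (x * 0 + y))) :=
      (tendsto_inv_atTop_zero.add_const 1).div
        ((tendsto_inv_atTop_zero.const_mul x).add_const y) (by simpa using hy.ne')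
    simpa using h
  have h_frac : Tendsto (fun t : ℝ => (x - y) / (1 + t)) atTop (𝓝 0) :=
    tendsto_const_nhds.div_atTop (tendsto_atTop_add_const_left _ 1 tendsto_id)
  have h_lim := ((h_ratio.log (inv_ne_zero hy.ne')).const_mul x).add h_frac
  rw [Real.log_inv, mul_neg, add_zero] at h_lim
  refine h_lim.congr' ?_
  filter_upwards [eventually_gt_atTop 0] with t ht
  have h_ratio_eq : (t⁻¹ + 1) / (x * t⁻¹ + y) = (1 + t) / (x + t * y) := by
    field_simp
  rw [resolventPrimitive, h_ratio_eq, Real.log_div (by positivity) (by positivity)]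

theorem resolventKernel_mul_nonneg (hx : 0 ≤ x) (hy : 0 ≤ y) {t : ℝ} (ht : 0 < t) :
    0 ≤ resolventKernel t x y * (t / (1 + t) ^ 2) := by
  rw [resolventKernel]
  positivity

theorem integrableOn_resolventKernel_mul (hx : 0 ≤ x) (hy : 0 ≤ y) (hxy : y = 0 → x = 0) :
    IntegrableOn (fun t => resolventKernel t x y * (t / (1 + t) ^ 2)) (Ioi 0) := by
  rcases hy.eq_or_lt with rfl | hy
  · simp [resolventKernel, hxy rfl]
  · exact integrableOn_Ioi_deriv_of_nonneg
      (continuousAt_resolventPrimitive_zero x y).continuousWithinAt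
      (fun _ ht => hasDerivAt_resolventPrimitive hx hy ht)
      (fun _ ht => resolventKernel_mul_nonneg hx hy.le ht)
      (tendsto_resolventPrimitive_atTop hx hy)

theorem integral_resolventKernel_mul (hx : 0 ≤ x) (hy : 0 ≤ y) (hxy : y = 0 → x = 0) :
    ∫ t in Ioi (0 : ℝ), resolventKernel t x y * (t / (1 + t) ^ 2) =
      x * Real.log x - x * Real.log y - x + y := by
  rcases hy.eq_or_lt with rfl | hy
  · simp [resolventKernel, hxy rfl]
  · rw [integral_Ioi_of_hasDerivAt_of_nonneg
      (continuousAt_resolventPrimitive_zero x y).continuousWithinAt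
      (fun _ ht => hasDerivAt_resolventPrimitive hx hy ht)
      (fun _ ht => resolventKernel_mul_nonneg hx hy.le ht)
      (tendsto_resolventPrimitive_atTop hx hy)]
    simp only [resolventPrimitive, add_zero, Real.log_one, zero_mul, div_one]
    ring

end ScalarIntegral

section SpectralSum

variable {𝕜 n : Type*} [RCLike 𝕜] [Fintype n] [DecidableEq n] {A B : Matrix n n 𝕜}

/-- The entries `⟨uᵢ, X vⱼ⟩` of `X` with respect to the eigenbases `u` of `A` and `v` of `B`. -/
noncomputable def eigenCoord (hA : A.IsHermitian) (hB : B.IsHermitian) (X : Matrix n n 𝕜) :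
    Matrix n n 𝕜 :=
  (hA.eigenvectorUnitary : Matrix n n 𝕜)ᴴ * X * (hB.eigenvectorUnitary : Matrix n n 𝕜)

theorem conjTranspose_eigenvectorUnitary_mul_self (hA : A.IsHermitian) :
    (hA.eigenvectorUnitary : Matrix n n 𝕜)ᴴ * (hA.eigenvectorUnitary : Matrix n n 𝕜) = 1 :=
  Unitary.coe_star_mul_self hA.eigenvectorUnitary

theorem eigenvectorUnitary_mul_conjTranspose_self (hA : A.IsHermitian) :
    (hA.eigenvectorUnitary : Matrix n n 𝕜) * (hA.eigenvectorUnitary : Matrix n n 𝕜)ᴴ = 1 :=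
  Unitary.coe_mul_star_self hA.eigenvectorUnitary

theorem cfc_eq_eigenvectorUnitary_mul_diagonal_mul (hA : A.IsHermitian) (f : ℝ → ℝ) :
    cfc f A = (hA.eigenvectorUnitary : Matrix n n 𝕜) *
      diagonal (fun i => (f (hA.eigenvalues i) : 𝕜)) *
        (hA.eigenvectorUnitary : Matrix n n 𝕜)ᴴ :=
  hA.cfc_eq f

theorem mul_cfc_self (hA : A.IsHermitian) (f : ℝ → ℝ) :
    A * cfc f A = cfc (fun x => x * f x) A := by
  rw [cfc_mul (fun x => x) f A (finite_real_spectrum.continuousOn _)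
    (finite_real_spectrum.continuousOn _), cfc_id' ℝ A hA.isSelfAdjoint]

theorem eigenCoord_sub (hA : A.IsHermitian) (hB : B.IsHermitian) (X Y : Matrix n n 𝕜) :
    eigenCoord hA hB (X - Y) = eigenCoord hA hB X - eigenCoord hA hB Y := by
  simp only [eigenCoord, Matrix.mul_sub, Matrix.sub_mul]

theorem eigenCoord_surjective (hA : A.IsHermitian) (hB : B.IsHermitian) :
    Function.Surjective (eigenCoord hA hB) := fun Z => by
  refine ⟨(hA.eigenvectorUnitary : Matrix n n 𝕜) * Z * (hB.eigenvectorUnitary : Matrix n n 𝕜)ᴴ, ?_⟩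
  rw [eigenCoord, ← Matrix.mul_assoc, ← Matrix.mul_assoc,
    conjTranspose_eigenvectorUnitary_mul_self, Matrix.one_mul, Matrix.mul_assoc,
    conjTranspose_eigenvectorUnitary_mul_self, Matrix.mul_one]

theorem eigenCoord_cfc_mul (hA : A.IsHermitian) (hB : B.IsHermitian) (f : ℝ → ℝ)
    (X : Matrix n n 𝕜) (i j : n) :
    eigenCoord hA hB (cfc f A * X) i j = f (hA.eigenvalues i) * eigenCoord hA hB X i j := by
  rw [eigenCoord, cfc_eq_eigenvectorUnitary_mul_diagonal_mul hA]
  simp only [← Matrix.mul_assoc, conjTranspose_eigenvectorUnitary_mul_self, Matrix.one_mul]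
  simp only [Matrix.mul_assoc, diagonal_mul, eigenCoord]

theorem eigenCoord_mul_cfc (hA : A.IsHermitian) (hB : B.IsHermitian) (g : ℝ → ℝ)
    (X : Matrix n n 𝕜) (i j : n) :
    eigenCoord hA hB (X * cfc g B) i j = eigenCoord hA hB X i j * g (hB.eigenvalues j) := by
  rw [eigenCoord, cfc_eq_eigenvectorUnitary_mul_diagonal_mul hB]
  simp only [Matrix.mul_assoc, conjTranspose_eigenvectorUnitary_mul_self, Matrix.mul_one]
  simp only [← Matrix.mul_assoc, mul_diagonal, eigenCoord]

theorem eigenCoord_mul_left (hA : A.IsHermitian) (hB : B.IsHermitian) (X : Matrix n n 𝕜)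
    (i j : n) :
    eigenCoord hA hB (A * X) i j = hA.eigenvalues i * eigenCoord hA hB X i j := by
  simpa only [cfc_id ℝ A hA.isSelfAdjoint, id] using eigenCoord_cfc_mul hA hB id X i j

theorem eigenCoord_mul_right (hA : A.IsHermitian) (hB : B.IsHermitian) (X : Matrix n n 𝕜)
    (i j : n) :
    eigenCoord hA hB (X * B) i j = eigenCoord hA hB X i j * hB.eigenvalues j := by
  simpa only [cfc_id ℝ B hB.isSelfAdjoint, id] using eigenCoord_mul_cfc hA hB id X i j

theorem trace_mul_conjTranspose_eq_sum_eigenCoord (hA : A.IsHermitian) (hB : B.IsHermitian)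
    (X Y : Matrix n n 𝕜) :
    (X * Yᴴ).trace = ∑ i, ∑ j, eigenCoord hA hB X i j * star (eigenCoord hA hB Y i j) := by
  have h_unitary : (eigenCoord hA hB X * (eigenCoord hA hB Y)ᴴ).trace = (X * Yᴴ).trace := by
    simp only [eigenCoord, conjTranspose_mul, conjTranspose_conjTranspose]
    simp only [Matrix.mul_assoc]
    rw [← Matrix.mul_assoc _ (_)ᴴ, eigenvectorUnitary_mul_conjTranspose_self, Matrix.one_mul,
      trace_mul_comm, Matrix.mul_assoc, Matrix.mul_assoc,
      eigenvectorUnitary_mul_conjTranspose_self, Matrix.mul_one]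
  rw [← h_unitary]
  simp only [Matrix.trace, diag_apply, Matrix.mul_apply, conjTranspose_apply]

/-- The sum `∑ᵢⱼ |⟨uᵢ, vⱼ⟩|² f(aᵢ, bⱼ)` over the eigenvalues `a` of `A` and `b` of `B` with
eigenbases `u` and `v`; traces of products of functions of `A` and of `B` have this form. -/
noncomputable def spectralSum (hA : A.IsHermitian) (hB : B.IsHermitian) (f : ℝ → ℝ → ℝ) : ℝ :=
  ∑ i, ∑ j, ‖eigenCoord hA hB 1 i j‖ ^ 2 * f (hA.eigenvalues i) (hB.eigenvalues j)

theorem spectralSum_congr (hA : A.IsHermitian) (hB : B.IsHermitian) {f g : ℝ → ℝ → ℝ}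
    (h : ∀ i j, eigenCoord hA hB 1 i j ≠ 0 →
      f (hA.eigenvalues i) (hB.eigenvalues j) = g (hA.eigenvalues i) (hB.eigenvalues j)) :
    spectralSum hA hB f = spectralSum hA hB g := by
  refine Finset.sum_congr rfl fun i _ => Finset.sum_congr rfl fun j _ => ?_
  by_cases hij : eigenCoord hA hB 1 i j = 0
  · simp [hij]
  · rw [h i j hij]

theorem spectralSum_add (hA : A.IsHermitian) (hB : B.IsHermitian) (f g : ℝ → ℝ → ℝ) :
    spectralSum hA hB (fun x y => f x y + g x y) = spectralSum hA hB f + spectralSum hA hB g := by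
  simp only [spectralSum, mul_add, Finset.sum_add_distrib]

theorem spectralSum_sub (hA : A.IsHermitian) (hB : B.IsHermitian) (f g : ℝ → ℝ → ℝ) :
    spectralSum hA hB (fun x y => f x y - g x y) = spectralSum hA hB f - spectralSum hA hB g := by
  simp only [spectralSum, mul_sub, Finset.sum_sub_distrib]

theorem spectralSum_mul_const (hA : A.IsHermitian) (hB : B.IsHermitian) (f : ℝ → ℝ → ℝ) (r : ℝ) :
    spectralSum hA hB (fun x y => f x y * r) = spectralSum hA hB f * r := by
  simp only [spectralSum, Finset.sum_mul, mul_assoc]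

theorem re_trace_cfc_mul_cfc (hA : A.IsHermitian) (hB : B.IsHermitian) (f g : ℝ → ℝ) :
    RCLike.re (cfc f A * cfc g B).trace = spectralSum hA hB fun x y => f x * g y := by
  have h := trace_mul_conjTranspose_eq_sum_eigenCoord hA hB (cfc f A * 1 * cfc g B) 1
  rw [conjTranspose_one, Matrix.mul_one, Matrix.mul_one] at h
  rw [h, map_sum, spectralSum]
  refine Finset.sum_congr rfl fun i _ => ?_
  rw [map_sum]
  refine Finset.sum_congr rfl fun j _ => ?_
  have h_one := eigenCoord_cfc_mul hA hB f 1 i j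
  rw [Matrix.mul_one] at h_one
  rw [eigenCoord_mul_cfc, h_one]
  have h_term (z : 𝕜) (r s : ℝ) : r * z * s * star z = ((‖z‖ ^ 2 * (r * s) : ℝ) : 𝕜) := by
    push_cast
    rw [← RCLike.mul_conj, RCLike.star_def]
    ring
  rw [h_term, RCLike.ofReal_re]

theorem re_trace_cfc_left (hA : A.IsHermitian) (hB : B.IsHermitian) (f : ℝ → ℝ) :
    RCLike.re (cfc f A).trace = spectralSum hA hB fun x _ => f x := by
  simpa only [cfc_const_one ℝ B hB.isSelfAdjoint, Matrix.mul_one, mul_one] using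
    re_trace_cfc_mul_cfc hA hB f fun _ => 1

theorem re_trace_cfc_right (hA : A.IsHermitian) (hB : B.IsHermitian) (g : ℝ → ℝ) :
    RCLike.re (cfc g B).trace = spectralSum hA hB fun _ y => g y := by
  simpa only [cfc_const_one ℝ A hA.isSelfAdjoint, Matrix.one_mul, one_mul] using
    re_trace_cfc_mul_cfc hA hB (fun _ => 1) g

section Integral

variable {α : Type*} [MeasurableSpace α] {μ : Measure α} {F : α → ℝ → ℝ → ℝ}

theorem integrable_spectralSum_term (hA : A.IsHermitian) (hB : B.IsHermitian)
    (hF : ∀ i j, eigenCoord hA hB 1 i j ≠ 0 →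
      Integrable (fun t => F t (hA.eigenvalues i) (hB.eigenvalues j)) μ) (i j : n) :
    Integrable (fun t => ‖eigenCoord hA hB 1 i j‖ ^ 2 *
      F t (hA.eigenvalues i) (hB.eigenvalues j)) μ := by
  by_cases hij : eigenCoord hA hB 1 i j = 0
  · simp [hij]
  · exact (hF i j hij).const_mul _

theorem integrable_spectralSum (hA : A.IsHermitian) (hB : B.IsHermitian)
    (hF : ∀ i j, eigenCoord hA hB 1 i j ≠ 0 →
      Integrable (fun t => F t (hA.eigenvalues i) (hB.eigenvalues j)) μ) :
    Integrable (fun t => spectralSum hA hB (F t)) μ :=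
  integrable_finsetSum _ fun i _ => integrable_finsetSum _ fun j _ =>
    integrable_spectralSum_term hA hB hF i j

theorem integral_spectralSum (hA : A.IsHermitian) (hB : B.IsHermitian)
    (hF : ∀ i j, eigenCoord hA hB 1 i j ≠ 0 →
      Integrable (fun t => F t (hA.eigenvalues i) (hB.eigenvalues j)) μ) :
    ∫ t, spectralSum hA hB (F t) ∂μ = spectralSum hA hB fun x y => ∫ t, F t x y ∂μ := by
  have h_term := integrable_spectralSum_term hA hB hF
  simp only [spectralSum]
  rw [integral_finsetSum _ fun i _ => integrable_finsetSum _ fun j _ => h_term i j]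
  refine Finset.sum_congr rfl fun i _ => ?_
  rw [integral_finsetSum _ fun j _ => h_term i j]
  exact Finset.sum_congr rfl fun j _ => integral_const_mul _ _

end Integral

end SpectralSum

section RelativeEntropy

variable {𝕜 n : Type*} [RCLike 𝕜] [Fintype n] {A B : Matrix n n 𝕜} {t : ℝ}

/-- The concave quadratic functional of `X` whose maximum is the quadratic form
`⟨A - B, (L_A + t R_B)⁻¹ (A - B)⟩`, where `L_A` and `R_B` denote left multiplication by `A` and
right multiplication by `B`. -/
noncomputable def resolventForm (t : ℝ) (A B X : Matrix n n 𝕜) : ℝ :=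
  2 * RCLike.re ((A - B) * Xᴴ).trace - RCLike.re (A * X * Xᴴ).trace -
    t * RCLike.re (X * B * Xᴴ).trace

theorem two_mul_re_mul_star_sub_le {k s : ℝ} (hs : 0 ≤ s) (hk : s = 0 → k = 0) (w z : 𝕜) :
    2 * k * RCLike.re (w * star z) - s * ‖z‖ ^ 2 ≤ ‖w‖ ^ 2 * (k ^ 2 / s) := by
  rcases hs.eq_or_lt with rfl | hs
  · simp [hk rfl]
  · rw [← mul_div_assoc, le_div_iff₀ hs]
    have h_square : 0 ≤ ‖(k : 𝕜) * w - (s : 𝕜) * z‖ ^ 2 := sq_nonneg _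
    simp only [RCLike.norm_sq_eq_def, RCLike.star_def, map_sub, RCLike.mul_re, RCLike.mul_im,
      RCLike.conj_re, RCLike.conj_im, RCLike.ofReal_re, RCLike.ofReal_im] at h_square ⊢
    linarith

theorem two_mul_re_mul_star_sub_eq (k s : ℝ) (w : 𝕜) :
    2 * k * RCLike.re (w * star (((k / s : ℝ) : 𝕜) * w)) - s * ‖((k / s : ℝ) : 𝕜) * w‖ ^ 2 =
      ‖w‖ ^ 2 * (k ^ 2 / s) := by
  rcases eq_or_ne s 0 with rfl | hs
  · simp
  · simp only [RCLike.norm_sq_eq_def, RCLike.star_def, RCLike.mul_re, RCLike.mul_im,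
      RCLike.conj_re, RCLike.conj_im, RCLike.ofReal_re, RCLike.ofReal_im]
    field_simp
    ring

variable [DecidableEq n]

theorem resolventForm_eq_sum_eigenCoord (hA : A.IsHermitian) (hB : B.IsHermitian) (t : ℝ)
    (X : Matrix n n 𝕜) :
    resolventForm t A B X = ∑ i, ∑ j,
      (2 * (hA.eigenvalues i - hB.eigenvalues j) *
          RCLike.re (eigenCoord hA hB 1 i j * star (eigenCoord hA hB X i j)) -
        (hA.eigenvalues i + t * hB.eigenvalues j) * ‖eigenCoord hA hB X i j‖ ^ 2) := by
  have h_sub (i j : n) : eigenCoord hA hB (A - B) i j =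
      ((hA.eigenvalues i - hB.eigenvalues j : ℝ) : 𝕜) * eigenCoord hA hB 1 i j := by
    have h_left := eigenCoord_mul_left hA hB 1 i j
    have h_right := eigenCoord_mul_right hA hB 1 i j
    rw [Matrix.mul_one] at h_left
    rw [Matrix.one_mul] at h_right
    rw [eigenCoord_sub, Matrix.sub_apply, h_left, h_right]
    push_cast
    ring
  simp only [resolventForm, trace_mul_conjTranspose_eq_sum_eigenCoord hA hB, h_sub,
    eigenCoord_mul_left, eigenCoord_mul_right, map_sum, Finset.mul_sum,
    ← Finset.sum_sub_distrib]
  refine Finset.sum_congr rfl fun i _ => Finset.sum_congr rfl fun j _ => ?_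
  rw [mul_right_comm _ (hB.eigenvalues j : 𝕜), mul_comm _ (hB.eigenvalues j : 𝕜)]
  simp only [mul_assoc, RCLike.re_ofReal_mul, RCLike.star_def, RCLike.mul_conj,
    ← RCLike.ofReal_pow, RCLike.ofReal_re]
  ring

theorem isGreatest_range_resolventForm (hA : A.PosSemidef) (hB : B.PosSemidef) (ht : 0 < t) :
    IsGreatest (range (resolventForm t A B))
      (spectralSum hA.isHermitian hB.isHermitian (resolventKernel t)) := by
  constructor
  · obtain ⟨X, hX⟩ := eigenCoord_surjective hA.isHermitian hB.isHermitian <| Matrix.of fun i j =>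
      (((hA.isHermitian.eigenvalues i - hB.isHermitian.eigenvalues j) /
        (hA.isHermitian.eigenvalues i + t * hB.isHermitian.eigenvalues j) : ℝ) : 𝕜) *
          eigenCoord hA.isHermitian hB.isHermitian 1 i j
    refine ⟨X, ?_⟩
    rw [resolventForm_eq_sum_eigenCoord hA.isHermitian hB.isHermitian, hX]
    exact Finset.sum_congr rfl fun i _ => Finset.sum_congr rfl fun j _ =>
      two_mul_re_mul_star_sub_eq _ _ _
  · rintro _ ⟨X, rfl⟩
    rw [resolventForm_eq_sum_eigenCoord hA.isHermitian hB.isHermitian]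
    refine Finset.sum_le_sum fun i _ => Finset.sum_le_sum fun j _ => ?_
    have ha := hA.eigenvalues_nonneg i
    have hb := mul_nonneg ht.le (hB.eigenvalues_nonneg j)
    refine two_mul_re_mul_star_sub_le (add_nonneg ha hb) (fun h => ?_) _ _
    obtain ⟨ha₀, hb₀⟩ := (add_eq_zero_iff_of_nonneg ha hb).1 h
    rw [ha₀, (mul_eq_zero.1 hb₀).resolve_left ht.ne', sub_zero]

theorem eigenvalues_eq_zero_of_ker_le (hA : A.IsHermitian) (hB : B.IsHermitian)
    (hAB : ∀ v, B *ᵥ v = 0 → A *ᵥ v = 0) {i j : n} (hij : eigenCoord hA hB 1 i j ≠ 0)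
    (hj : hB.eigenvalues j = 0) : hA.eigenvalues i = 0 := by
  have h_ker : A *ᵥ (hB.eigenvectorUnitary : Matrix n n 𝕜).col j = 0 := by
    refine hAB _ ?_
    rw [show (hB.eigenvectorUnitary : Matrix n n 𝕜).col j = ⇑(hB.eigenvectorBasis j) from
      funext fun k => hB.eigenvectorUnitary_apply k j, hB.mulVec_eigenvectorBasis, hj, zero_smul]
  have h_coord : eigenCoord hA hB (A * 1) i j = 0 := by
    rw [eigenCoord, Matrix.mul_one, Matrix.mul_assoc, Matrix.mul_apply]
    exact Finset.sum_eq_zero fun k _ => mul_eq_zero_of_right _ (congrFun h_ker k)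
  rw [eigenCoord_mul_left] at h_coord
  exact RCLike.ofReal_eq_zero.1 ((mul_eq_zero.1 h_coord).resolve_right hij)

/-- The Umegaki relative entropy `Tr A log A - Tr A log B`. Since `Real.log 0 = 0`, it is
meaningful only when the kernel of `B` is contained in that of `A`. -/
noncomputable def relEntropy (A B : Matrix n n 𝕜) : ℝ :=
  RCLike.re (A * cfc Real.log A).trace - RCLike.re (A * cfc Real.log B).trace

theorem relEntropy_sub_trace_add_trace_eq_spectralSum (hA : A.IsHermitian) (hB : B.IsHermitian) :
    relEntropy A B - RCLike.re A.trace + RCLike.re B.trace =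
      spectralSum hA hB fun x y => x * Real.log x - x * Real.log y - x + y := by
  have h_self : RCLike.re (A * cfc Real.log A).trace =
      spectralSum hA hB fun x _ => x * Real.log x := by
    rw [mul_cfc_self hA, re_trace_cfc_left hA hB]
  have h_cross : RCLike.re (A * cfc Real.log B).trace =
      spectralSum hA hB fun x y => x * Real.log y := by
    simpa only [cfc_id ℝ A hA.isSelfAdjoint, id] using re_trace_cfc_mul_cfc hA hB id Real.log
  have h_left : RCLike.re A.trace = spectralSum hA hB fun x _ => x := by
    simpa only [cfc_id ℝ A hA.isSelfAdjoint, id] using re_trace_cfc_left hA hB id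
  have h_right : RCLike.re B.trace = spectralSum hA hB fun _ y => y := by
    simpa only [cfc_id ℝ B hB.isSelfAdjoint, id] using re_trace_cfc_right hA hB id
  rw [relEntropy, h_self, h_cross, h_left, h_right, spectralSum_add, spectralSum_sub,
    spectralSum_sub]

theorem integrableOn_spectralSum_resolventKernel (hA : A.PosSemidef) (hB : B.PosSemidef)
    (hAB : ∀ v, B *ᵥ v = 0 → A *ᵥ v = 0) :
    IntegrableOn (fun t => spectralSum hA.isHermitian hB.isHermitian
      fun x y => resolventKernel t x y * (t / (1 + t) ^ 2)) (Ioi 0) :=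
  integrable_spectralSum _ _ fun i j hij => integrableOn_resolventKernel_mul
    (hA.eigenvalues_nonneg i) (hB.eigenvalues_nonneg j)
    (eigenvalues_eq_zero_of_ker_le hA.isHermitian hB.isHermitian hAB hij)

theorem integral_spectralSum_resolventKernel (hA : A.PosSemidef) (hB : B.PosSemidef)
    (hAB : ∀ v, B *ᵥ v = 0 → A *ᵥ v = 0) :
    ∫ t in Ioi (0 : ℝ), spectralSum hA.isHermitian hB.isHermitian
        (fun x y => resolventKernel t x y * (t / (1 + t) ^ 2)) =
      relEntropy A B - RCLike.re A.trace + RCLike.re B.trace := by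
  have h_ker {i j : n} := eigenvalues_eq_zero_of_ker_le hA.isHermitian hB.isHermitian hAB
    (i := i) (j := j)
  rw [relEntropy_sub_trace_add_trace_eq_spectralSum hA.isHermitian hB.isHermitian,
    integral_spectralSum (F := fun t x y => resolventKernel t x y * (t / (1 + t) ^ 2)) _ _
      fun i j hij => integrableOn_resolventKernel_mul (hA.eigenvalues_nonneg i)
        (hB.eigenvalues_nonneg j) (h_ker hij)]
  exact spectralSum_congr _ _ fun i j hij => integral_resolventKernel_mul
    (hA.eigenvalues_nonneg i) (hB.eigenvalues_nonneg j) (h_ker hij)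

end RelativeEntropy

section PartialTrace

variable {m n R : Type*} [CommSemiring R]

/-- The partial trace over the second tensor factor. -/
def partialTraceRight [Fintype n] : Matrix (m × n) (m × n) R →ₗ[R] Matrix m m R where
  toFun M := of fun i j => ∑ k, M (i, k) (j, k)
  map_add' M N := by
    ext
    simp [Finset.sum_add_distrib]
  map_smul' r M := by
    ext
    simp [Finset.mul_sum]

/-- The partial trace over the first tensor factor. -/
def partialTraceLeft [Fintype m] : Matrix (m × n) (m × n) R →ₗ[R] Matrix n n R where
  toFun M := of fun k l => ∑ i, M (i, k) (i, l)
  map_add' M N := by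
    ext
    simp [Finset.sum_add_distrib]
  map_smul' r M := by
    ext
    simp [Finset.mul_sum]

theorem partialTraceRight_apply [Fintype n] (M : Matrix (m × n) (m × n) R) (i j : m) :
    partialTraceRight M i j = ∑ k, M (i, k) (j, k) :=
  rfl

theorem partialTraceLeft_apply [Fintype m] (M : Matrix (m × n) (m × n) R) (k l : n) :
    partialTraceLeft M k l = ∑ i, M (i, k) (i, l) :=
  rfl

theorem partialTraceRight_eq_sum_submatrix [Fintype n] (M : Matrix (m × n) (m × n) R) :
    partialTraceRight M = ∑ k, M.submatrix (·, k) (·, k) := by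
  ext i j
  simp only [partialTraceRight_apply, Matrix.sum_apply, submatrix_apply]

theorem partialTraceLeft_eq_sum_submatrix [Fintype m] (M : Matrix (m × n) (m × n) R) :
    partialTraceLeft M = ∑ i, M.submatrix (i, ·) (i, ·) := by
  ext k l
  simp only [partialTraceLeft_apply, Matrix.sum_apply, submatrix_apply]

theorem partialTraceRight_kronecker [Fintype n] (A : Matrix m m R) (B : Matrix n n R) :
    partialTraceRight (A ⊗ₖ B) = B.trace • A := by
  ext i j
  simp only [partialTraceRight_apply, kronecker_apply, ← Finset.mul_sum, Matrix.smul_apply,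
    smul_eq_mul, Matrix.trace, diag_apply, mul_comm]

theorem partialTraceLeft_kronecker [Fintype m] (A : Matrix m m R) (B : Matrix n n R) :
    partialTraceLeft (A ⊗ₖ B) = A.trace • B := by
  ext k l
  simp only [partialTraceLeft_apply, kronecker_apply, ← Finset.sum_mul, Matrix.smul_apply,
    smul_eq_mul, Matrix.trace, diag_apply]

variable [Fintype m] [Fintype n]

theorem trace_partialTraceRight (M : Matrix (m × n) (m × n) R) :
    (partialTraceRight M).trace = M.trace := by
  simp only [Matrix.trace, diag_apply, partialTraceRight_apply, Fintype.sum_prod_type]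

theorem trace_partialTraceLeft (M : Matrix (m × n) (m × n) R) :
    (partialTraceLeft M).trace = M.trace := by
  simp only [Matrix.trace, diag_apply, partialTraceLeft_apply, Fintype.sum_prod_type_right]

theorem partialTraceRight_mul_kronecker_one [DecidableEq n] (M : Matrix (m × n) (m × n) R)
    (Y : Matrix m m R) :
    partialTraceRight (M * (Y ⊗ₖ (1 : Matrix n n R))) = partialTraceRight M * Y := by
  ext i j
  simp only [partialTraceRight_apply, Matrix.mul_apply, kronecker_apply, Matrix.one_apply, mul_ite,
    mul_one, mul_zero, Fintype.sum_prod_type, Finset.sum_ite_eq', Finset.mem_univ, if_true,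
    Finset.sum_mul]
  exact Finset.sum_comm

theorem partialTraceRight_kronecker_one_mul [DecidableEq n] (M : Matrix (m × n) (m × n) R)
    (Y : Matrix m m R) :
    partialTraceRight ((Y ⊗ₖ (1 : Matrix n n R)) * M) = Y * partialTraceRight M := by
  ext i j
  simp only [partialTraceRight_apply, Matrix.mul_apply, kronecker_apply, Matrix.one_apply, mul_ite,
    mul_one, mul_zero, Fintype.sum_prod_type, ite_mul, zero_mul, Finset.sum_ite_eq,
    Finset.mem_univ, if_true, Finset.mul_sum]
  exact Finset.sum_comm

theorem partialTraceLeft_kronecker_one_mul_comm [DecidableEq n] (Y : Matrix m m R)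
    (M : Matrix (m × n) (m × n) R) :
    partialTraceLeft ((Y ⊗ₖ (1 : Matrix n n R)) * M) =
      partialTraceLeft (M * (Y ⊗ₖ (1 : Matrix n n R))) := by
  ext k l
  simp only [partialTraceLeft_apply, Matrix.mul_apply, kronecker_apply, Matrix.one_apply, mul_ite,
    mul_one, mul_zero, Fintype.sum_prod_type, ite_mul, zero_mul, Finset.sum_ite_eq,
    Finset.sum_ite_eq', Finset.mem_univ, if_true]
  rw [Finset.sum_comm]
  simp only [mul_comm]

end PartialTrace

section PartialTracePosSemidef

variable {𝕜 m n : Type*} [RCLike 𝕜] [Fintype n]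

theorem posSemidef_partialTraceRight {M : Matrix (m × n) (m × n) 𝕜} (hM : M.PosSemidef) :
    (partialTraceRight M).PosSemidef := by
  rw [partialTraceRight_eq_sum_submatrix]
  exact posSemidef_sum _ fun k _ => hM.submatrix _

theorem posSemidef_partialTraceLeft {M : Matrix (n × m) (n × m) 𝕜} (hM : M.PosSemidef) :
    (partialTraceLeft M).PosSemidef := by
  rw [partialTraceLeft_eq_sum_submatrix]
  exact posSemidef_sum _ fun i _ => hM.submatrix _

open scoped MatrixOrder in
theorem posSemidef_partialTraceLeft_kronecker_one_mul [Fintype m] [DecidableEq n]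
    {X : Matrix m m 𝕜} (hX : X.PosSemidef) {M : Matrix (m × n) (m × n) 𝕜} (hM : M.PosSemidef) :
    (partialTraceLeft ((X ⊗ₖ (1 : Matrix n n 𝕜)) * M)).PosSemidef := by
  classical
  obtain ⟨B, rfl⟩ := CStarAlgebra.nonneg_iff_eq_star_mul_self.1 hX.nonneg
  have h_conj : partialTraceLeft (((star B * B) ⊗ₖ (1 : Matrix n n 𝕜)) * M) =
      partialTraceLeft ((B ⊗ₖ (1 : Matrix n n 𝕜)) * M * (B ⊗ₖ (1 : Matrix n n 𝕜))ᴴ) := by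
    rw [conjTranspose_kronecker, conjTranspose_one, ← partialTraceLeft_kronecker_one_mul_comm,
      ← Matrix.mul_assoc, ← mul_kronecker_mul, Matrix.one_mul, star_eq_conjTranspose]
  rw [h_conj]
  exact posSemidef_partialTraceLeft (hM.mul_mul_conjTranspose_same _)

theorem sum_mulVec_eq_zero_iff {ι : Type*} {s : Finset ι} {A : ι → Matrix n n 𝕜}
    (hA : ∀ k ∈ s, (A k).PosSemidef) {v : n → 𝕜} :
    (∑ k ∈ s, A k) *ᵥ v = 0 ↔ ∀ k ∈ s, A k *ᵥ v = 0 := by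
  rw [← (posSemidef_sum s hA).dotProduct_mulVec_zero_iff, sum_mulVec, dotProduct_sum,
    Finset.sum_eq_zero_iff_of_nonneg fun k hk => (hA k hk).dotProduct_mulVec_nonneg v]
  exact forall₂_congr fun k hk => (hA k hk).dotProduct_mulVec_zero_iff v

theorem submatrix_mulVec_eq_zero_iff [Fintype m] {A : Matrix n n 𝕜} (hA : A.PosSemidef) {f : m → n}
    (hf : f.Injective) {v : m → 𝕜} :
    A.submatrix f f *ᵥ v = 0 ↔ A *ᵥ Function.extend f v 0 = 0 := by
  have h_dotProduct (w : n → 𝕜) : w ⬝ᵥ Function.extend f v 0 = (w ∘ f) ⬝ᵥ v :=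
    (Fintype.sum_of_injective f hf _ _
      (fun i hi => by rw [Function.extend_apply' _ _ _ hi, Pi.zero_apply, mul_zero])
      (fun i => by rw [hf.extend_apply, Function.comp_apply])).symm
  have h_mulVec : A.submatrix f f *ᵥ v = (A *ᵥ Function.extend f v 0) ∘ f :=
    funext fun i => (h_dotProduct _).symm
  refine ⟨fun h => (hA.dotProduct_mulVec_zero_iff _).1 ?_, fun h => by rw [h_mulVec, h]; rfl⟩
  rw [star_dotProduct, h_dotProduct]
  change star (star ((A *ᵥ Function.extend f v 0) ∘ f) ⬝ᵥ v) = 0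
  rw [← h_mulVec, h, star_zero, zero_dotProduct, star_zero]

theorem partialTraceRight_mulVec_eq_zero_iff [Fintype m] {M : Matrix (m × n) (m × n) 𝕜}
    (hM : M.PosSemidef) {v : m → 𝕜} :
    partialTraceRight M *ᵥ v = 0 ↔ ∀ k, M *ᵥ Function.extend (·, k) v 0 = 0 := by
  rw [partialTraceRight_eq_sum_submatrix,
    sum_mulVec_eq_zero_iff fun k _ => hM.submatrix _]
  simp only [Finset.mem_univ, true_imp_iff,
    submatrix_mulVec_eq_zero_iff hM (Prod.mk_left_injective _)]

end PartialTracePosSemidef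

section Monotonicity

variable {𝕜 m n : Type*} [RCLike 𝕜] [Fintype m] [Fintype n] [DecidableEq n]
  {A B : Matrix (m × n) (m × n) 𝕜}

theorem resolventForm_kronecker_one (t : ℝ) (A B : Matrix (m × n) (m × n) 𝕜) (X : Matrix m m 𝕜) :
    resolventForm t A B (X ⊗ₖ (1 : Matrix n n 𝕜)) =
      resolventForm t (partialTraceRight A) (partialTraceRight B) X := by
  simp only [resolventForm, conjTranspose_kronecker, conjTranspose_one,
    ← trace_partialTraceRight (m := m), partialTraceRight_mul_kronecker_one,
    partialTraceRight_kronecker_one_mul, map_sub]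

variable [DecidableEq m]

theorem spectralSum_resolventKernel_partialTraceRight_le (hA : A.PosSemidef) (hB : B.PosSemidef)
    {t : ℝ} (ht : 0 < t) :
    spectralSum (posSemidef_partialTraceRight hA).isHermitian
        (posSemidef_partialTraceRight hB).isHermitian (resolventKernel t) ≤
      spectralSum hA.isHermitian hB.isHermitian (resolventKernel t) := by
  obtain ⟨X, hX⟩ := (isGreatest_range_resolventForm (posSemidef_partialTraceRight hA)
    (posSemidef_partialTraceRight hB) ht).1
  rw [← hX, ← resolventForm_kronecker_one]
  exact (isGreatest_range_resolventForm hA hB ht).2 (mem_range_self _)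

theorem relEntropy_partialTraceRight_le (hA : A.PosSemidef) (hB : B.PosSemidef)
    (hAB : ∀ v, B *ᵥ v = 0 → A *ᵥ v = 0) :
    relEntropy (partialTraceRight A) (partialTraceRight B) ≤ relEntropy A B := by
  have hA' := posSemidef_partialTraceRight hA
  have hB' := posSemidef_partialTraceRight hB
  have hAB' (v : m → 𝕜) (hv : partialTraceRight B *ᵥ v = 0) : partialTraceRight A *ᵥ v = 0 :=
    (partialTraceRight_mulVec_eq_zero_iff hA).2 fun k =>
      hAB _ ((partialTraceRight_mulVec_eq_zero_iff hB).1 hv k)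
  have h_mono := setIntegral_mono_on
    (integrableOn_spectralSum_resolventKernel hA' hB' hAB')
    (integrableOn_spectralSum_resolventKernel hA hB hAB) measurableSet_Ioi
    fun t (ht : 0 < t) => by
      simp only [spectralSum_mul_const]
      exact mul_le_mul_of_nonneg_right
        (spectralSum_resolventKernel_partialTraceRight_le hA hB ht) (by positivity)
  rw [integral_spectralSum_resolventKernel hA' hB' hAB',
    integral_spectralSum_resolventKernel hA hB hAB, trace_partialTraceRight,
    trace_partialTraceRight] at h_mono
  linarith

end Monotonicity

section Entropy

variable {n m ι : Type*} [Fintype n] [Fintype m] [Fintype ι]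

theorem IsDensityMatrix.kronecker {A : Matrix n n ℂ} {B : Matrix m m ℂ} (hA : IsDensityMatrix A)
    (hB : IsDensityMatrix B) : IsDensityMatrix (A ⊗ₖ B) :=
  ⟨hA.posSemidef.kronecker hB.posSemidef, by
    rw [trace_kronecker, hA.trace_eq_one, hB.trace_eq_one, one_mul]⟩

theorem IsDensityMatrix.partialTraceRight {A : Matrix (n × m) (n × m) ℂ} (hA : IsDensityMatrix A) :
    IsDensityMatrix (partialTraceRight A) :=
  ⟨posSemidef_partialTraceRight hA.posSemidef, by rw [trace_partialTraceRight, hA.trace_eq_one]⟩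

theorem isDensityMatrix_sum_smul {p : ι → ℝ} (hp : p ∈ stdSimplex ℝ ι) {R : ι → Matrix n n ℂ}
    (hR : ∀ k, IsDensityMatrix (R k)) : IsDensityMatrix (∑ k, p k • R k) := by
  refine ⟨posSemidef_sum _ fun k _ => (hR k).posSemidef.smul (hp.1 k), ?_⟩
  simp only [trace_sum, trace_smul, (hR _).trace_eq_one, ← Finset.sum_smul, hp.2, one_smul]

variable [DecidableEq n] [DecidableEq m]

theorem IsDensityMatrix.sum_eigenvalues {A : Matrix n n ℂ} (hA : IsDensityMatrix A) :
    ∑ i, hA.posSemidef.isHermitian.eigenvalues i = 1 := by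
  have h_trace := hA.posSemidef.isHermitian.trace_eq_sum_eigenvalues
  rw [hA.trace_eq_one, ← RCLike.ofReal_sum] at h_trace
  exact Complex.ofReal_injective h_trace.symm

theorem vonNeumannEntropy_eq_sum_eigenvalues {A : Matrix n n ℂ} (hA : A.IsHermitian) :
    vonNeumannEntropy A = ∑ i, Real.negMulLog (hA.eigenvalues i) := by
  have h_trace : (A * cfc Real.log A).trace =
      ∑ i, ((hA.eigenvalues i * Real.log (hA.eigenvalues i) : ℝ) : ℂ) := by
    rw [mul_cfc_self hA, cfc_eq_eigenvectorUnitary_mul_diagonal_mul hA, trace_mul_cycle,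
      conjTranspose_eigenvectorUnitary_mul_self, Matrix.one_mul, trace_diagonal]
    rfl
  rw [vonNeumannEntropy, h_trace, Complex.re_sum, ← Finset.sum_neg_distrib]
  simp only [Complex.ofReal_re, Real.negMulLog, neg_mul]

theorem vonNeumannEntropy_nonneg {A : Matrix n n ℂ} (hA : IsDensityMatrix A) :
    0 ≤ vonNeumannEntropy A := by
  rw [vonNeumannEntropy_eq_sum_eigenvalues hA.posSemidef.isHermitian]
  have h_nonneg := hA.posSemidef.eigenvalues_nonneg
  refine Finset.sum_nonneg fun i _ => Real.negMulLog_nonneg (h_nonneg i) ?_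
  rw [← hA.sum_eigenvalues]
  exact Finset.single_le_sum (fun j _ => h_nonneg j) (Finset.mem_univ i)

theorem vonNeumannEntropy_eq_sum_of_charpoly {A : Matrix n n ℂ} (hA : A.IsHermitian) (e : ι → ℝ)
    (h : A.charpoly = ∏ i, (Polynomial.X - Polynomial.C (e i : ℂ))) :
    vonNeumannEntropy A = ∑ i, Real.negMulLog (e i) := by
  have h_roots : A.charpoly.roots = Finset.univ.val.map fun i => (e i : ℂ) := by
    rw [h, Polynomial.roots_prod _ _ (Finset.prod_ne_zero_iff.2 fun i _ =>
      Polynomial.X_sub_C_ne_zero _)]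
    simp only [Polynomial.roots_X_sub_C, Multiset.bind_singleton]
  rw [hA.roots_charpoly_eq_eigenvalues] at h_roots
  have h_sum := congrArg (fun s => (s.map fun z : ℂ => Real.negMulLog z.re).sum) h_roots
  simp only [Multiset.map_map] at h_sum
  rw [vonNeumannEntropy_eq_sum_eigenvalues hA]
  exact h_sum

theorem charpoly_kronecker {A : Matrix n n ℂ} {B : Matrix m m ℂ} (hA : A.IsHermitian)
    (hB : B.IsHermitian) :
    (A ⊗ₖ B).charpoly = ∏ x : n × m, (Polynomial.X -
      Polynomial.C ((hA.eigenvalues x.1 * hB.eigenvalues x.2 : ℝ) : ℂ)) := by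
  have h_diag : A ⊗ₖ B =
      (hA.eigenvectorUnitary : Matrix n n ℂ) ⊗ₖ (hB.eigenvectorUnitary : Matrix m m ℂ) *
        diagonal (fun x => ((hA.eigenvalues x.1 * hB.eigenvalues x.2 : ℝ) : ℂ)) *
        (hA.eigenvectorUnitary : Matrix n n ℂ)ᴴ ⊗ₖ (hB.eigenvectorUnitary : Matrix m m ℂ)ᴴ := by
    have h_eigen := diagonal_kronecker_diagonal (fun i => (hA.eigenvalues i : ℂ))
      fun j => (hB.eigenvalues j : ℂ)
    simp only [Complex.ofReal_mul, ← h_eigen, ← mul_kronecker_mul]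
    conv_lhs => rw [hA.spectral_theorem, hB.spectral_theorem]
    rfl
  rw [h_diag, Matrix.mul_assoc, charpoly_mul_comm, Matrix.mul_assoc, ← mul_kronecker_mul,
    conjTranspose_eigenvectorUnitary_mul_self, conjTranspose_eigenvectorUnitary_mul_self,
    one_kronecker_one, Matrix.mul_one, charpoly_diagonal]

theorem vonNeumannEntropy_kronecker {A : Matrix n n ℂ} {B : Matrix m m ℂ}
    (hA : IsDensityMatrix A) (hB : IsDensityMatrix B) :
    vonNeumannEntropy (A ⊗ₖ B) = vonNeumannEntropy A + vonNeumannEntropy B := by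
  rw [vonNeumannEntropy_eq_sum_of_charpoly (hA.kronecker hB).posSemidef.isHermitian _
    (charpoly_kronecker hA.posSemidef.isHermitian hB.posSemidef.isHermitian),
    vonNeumannEntropy_eq_sum_eigenvalues hA.posSemidef.isHermitian,
    vonNeumannEntropy_eq_sum_eigenvalues hB.posSemidef.isHermitian, Fintype.sum_prod_type]
  simp only [Real.negMulLog_mul, Finset.sum_add_distrib, ← Finset.sum_mul, ← Finset.mul_sum,
    hA.sum_eigenvalues, hB.sum_eigenvalues, one_mul]

end Entropy

section Holevo

variable {n m ι : Type*} [Fintype n] [DecidableEq n] [Fintype m] [DecidableEq m] [Fintype ι]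
  {p : ι → ℝ}

/-- The Holevo quantity `S(∑ₖ pₖ Rₖ) - ∑ₖ pₖ S(Rₖ)` of the ensemble of matrices `Rₖ` with
weights `pₖ`. -/
noncomputable def holevo (p : ι → ℝ) (R : ι → Matrix n n ℂ) : ℝ :=
  vonNeumannEntropy (∑ k, p k • R k) - ∑ k, p k * vonNeumannEntropy (R k)

theorem holevo_eq_sum_mul_relEntropy (p : ι → ℝ) (R : ι → Matrix n n ℂ) :
    holevo p R = ∑ k, p k * relEntropy (R k) (∑ l, p l • R l) := by
  have h_mean (L : Matrix n n ℂ) :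
      ((∑ k, p k • R k) * L).trace.re = ∑ k, p k * (R k * L).trace.re := by
    simp only [Finset.sum_mul, trace_sum, Complex.re_sum, Matrix.smul_mul, trace_smul,
      Complex.real_smul, Complex.re_ofReal_mul]
  simp only [holevo, vonNeumannEntropy, h_mean, relEntropy, RCLike.re_to_complex, mul_sub,
    mul_neg, Finset.sum_sub_distrib, Finset.sum_neg_distrib]
  ring

theorem holevo_partialTraceRight_le (hp : ∀ k, 0 ≤ p k) {R : ι → Matrix (n × m) (n × m) ℂ}
    (hR : ∀ k, (R k).PosSemidef) :
    holevo p (fun k => partialTraceRight (R k)) ≤ holevo p R := by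
  have h_smul (k : ι) : (p k • R k).PosSemidef := (hR k).smul (hp k)
  have h_map : ∑ k, p k • partialTraceRight (R k) = partialTraceRight (∑ k, p k • R k) := by
    simp only [map_sum, LinearMap.map_smul_of_tower]
  rw [holevo_eq_sum_mul_relEntropy, holevo_eq_sum_mul_relEntropy, h_map]
  refine Finset.sum_le_sum fun k _ => ?_
  rcases (hp k).eq_or_lt with hk | hk
  · simp only [← hk, zero_mul, le_refl]
  · refine mul_le_mul_of_nonneg_left (relEntropy_partialTraceRight_le (hR k)
      (posSemidef_sum _ fun l _ => h_smul l) fun v hv => ?_) hk.le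
    have h_ker := (sum_mulVec_eq_zero_iff fun l _ => h_smul l).1 hv k (Finset.mem_univ k)
    rw [smul_mulVec] at h_ker
    exact (smul_eq_zero.1 h_ker).resolve_left hk.ne'

theorem vonNeumannEntropy_sum_smul_add_le (hp : ∀ k, 0 ≤ p k) {R : ι → Matrix n n ℂ}
    (hR : ∀ k, IsDensityMatrix (R k)) {T : ι → Matrix m m ℂ} (hT : ∀ k, IsDensityMatrix (T k)) :
    vonNeumannEntropy (∑ k, p k • R k) + ∑ k, p k * vonNeumannEntropy (T k) ≤
      vonNeumannEntropy (∑ k, p k • (R k ⊗ₖ T k)) := by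
  have h_holevo := holevo_partialTraceRight_le hp
    fun k => ((hR k).kronecker (hT k)).posSemidef
  simp only [holevo, partialTraceRight_kronecker, (hT _).trace_eq_one, one_smul,
    vonNeumannEntropy_kronecker (hR _) (hT _), mul_add, Finset.sum_add_distrib] at h_holevo
  linarith

end Holevo

section Channels

variable {a b c d ι : Type*} [Fintype a] [Fintype b] [Fintype c] [Fintype d] [Fintype ι]

theorem linearMap_ext_kronecker {m n S N : Type*} [Finite m] [Finite n] [CommSemiring S]
    [AddCommMonoid N] [Module S N] {f g : Matrix (m × n) (m × n) S →ₗ[S] N}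
    (h : ∀ A B, f (A ⊗ₖ B) = g (A ⊗ₖ B)) : f = g := by
  classical
  refine Matrix.ext_linearMap S fun x y => LinearMap.ext_ring ?_
  simpa only [single_kronecker_single, mul_one, LinearMap.comp_apply, singleLinearMap_apply] using
    h (single x.1 y.1 1) (single x.2 y.2 1)

theorem exists_isDensityMatrix (a : Type*) [Fintype a] [Nonempty a] :
    ∃ ρ : Matrix a a ℂ, IsDensityMatrix ρ := by
  classical
  obtain ⟨i⟩ := ‹Nonempty a›
  refine ⟨diagonal (Pi.single i 1), PosSemidef.diagonal (Pi.single_nonneg.2 zero_le_one), ?_⟩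
  rw [trace_diagonal, Finset.sum_pi_single', if_pos (Finset.mem_univ i)]

theorem re_smul_eq_smul {M : Type*} [AddCommGroup M] [Module ℂ M] {z : ℂ} (hz : 0 ≤ z) (v : M) :
    z.re • v = z • v := by
  rw [← Complex.coe_smul, ← Complex.eq_re_of_ofReal_le hz]

theorem exists_isDensityMatrix_re_trace_smul_eq [Nonempty c] {Y : Matrix c c ℂ}
    (hY : Y.PosSemidef) : ∃ σ, IsDensityMatrix σ ∧ Y.trace.re • σ = Y := by
  simp only [re_smul_eq_smul hY.trace_nonneg]
  by_cases h : Y.trace = 0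
  · obtain ⟨σ, hσ⟩ := exists_isDensityMatrix c
    exact ⟨σ, hσ, by rw [h, zero_smul, hY.trace_eq_zero_iff.1 h]⟩
  · refine ⟨Y.trace⁻¹ • Y, ⟨hY.smul (inv_nonneg.2 hY.trace_nonneg), ?_⟩, ?_⟩
    · rw [trace_smul, smul_eq_mul, inv_mul_cancel₀ h]
    · rw [smul_smul, mul_inv_cancel₀ h, one_smul]

open scoped MatrixOrder in
theorem trace_mul_nonneg {𝕜 : Type*} [RCLike 𝕜] {A B : Matrix a a 𝕜} (hA : A.PosSemidef)
    (hB : B.PosSemidef) : 0 ≤ (A * B).trace := by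
  classical
  obtain ⟨C, rfl⟩ := CStarAlgebra.nonneg_iff_eq_star_mul_self.1 hA.nonneg
  rw [Matrix.mul_assoc, trace_mul_comm]
  exact (hB.mul_mul_conjTranspose_same C).trace_nonneg

theorem re_trace_mul_mem_stdSimplex [DecidableEq a] {X : ι → Matrix a a ℂ}
    (hX : ∀ k, (X k).PosSemidef) (hX_sum : ∑ k, X k = 1) {ρ : Matrix a a ℂ}
    (hρ : IsDensityMatrix ρ) : (fun k => (X k * ρ).trace.re) ∈ stdSimplex ℝ ι := by
  refine ⟨fun k => (Complex.nonneg_iff.1 (trace_mul_nonneg (hX k) hρ.posSemidef)).1, ?_⟩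
  rw [← Complex.re_sum, ← trace_sum, ← Finset.sum_mul, hX_sum, Matrix.one_mul, hρ.trace_eq_one,
    Complex.one_re]

theorem tensorMap_eq_sum_kronecker {b d : Type*} [DecidableEq a] [DecidableEq c]
    {Φ : Matrix a a ℂ →ₗ[ℂ] Matrix b b ℂ} {R : ι → Matrix b b ℂ} {X : ι → Matrix a a ℂ}
    (hΦ : ∀ ρ, Φ ρ = ∑ k, (X k * ρ).trace • R k) (Ω : Matrix c c ℂ →ₗ[ℂ] Matrix d d ℂ)
    (ρ : Matrix (a × c) (a × c) ℂ) :
    tensorMap Φ Ω ρ =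
      ∑ k, R k ⊗ₖ Ω (partialTraceLeft ((X k ⊗ₖ (1 : Matrix c c ℂ)) * ρ)) := by
  have h_linear : tensorMap Φ Ω =
      ∑ k, kroneckerBilinear (R := ℂ) (R k) ∘ₗ Ω ∘ₗ partialTraceLeft ∘ₗ
        LinearMap.mulLeft ℂ (X k ⊗ₖ (1 : Matrix c c ℂ)) := by
    refine linearMap_ext_kronecker fun A B => ?_
    calc tensorMap Φ Ω (A ⊗ₖ B) = kroneckerBilinear (R := ℂ) (Φ A) (Ω B) :=
          tensorMap_kronecker Φ Ω A B
      _ = ∑ k, R k ⊗ₖ Ω (partialTraceLeft ((X k ⊗ₖ (1 : Matrix c c ℂ)) * (A ⊗ₖ B))) := by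
          simp only [hΦ, map_sum, LinearMap.sum_apply, map_smul, LinearMap.smul_apply,
            ← mul_kronecker_mul, Matrix.one_mul, partialTraceLeft_kronecker, kronecker_smul]
          rfl
      _ = _ := by
          rw [LinearMap.sum_apply]
          rfl
  rw [h_linear, LinearMap.sum_apply]
  rfl

/-- A positive trace-preserving map, described by its action on density matrices. -/
def PreservesStates (Φ : Matrix a a ℂ →ₗ[ℂ] Matrix b b ℂ) : Prop :=
  ∀ ρ, IsDensityMatrix ρ → IsDensityMatrix (Φ ρ)

theorem IsChannel.preservesStates [DecidableEq c] {Ω : Matrix c c ℂ →ₗ[ℂ] Matrix d d ℂ}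
    (hΩ : IsChannel Ω) : PreservesStates Ω := by
  refine fun σ hσ => ⟨?_, by rw [hΩ.trace_map, hσ.trace_eq_one]⟩
  have h_ampliation := hΩ.completelyPositive 1 ((1 : Matrix (Fin 1) (Fin 1) ℂ) ⊗ₖ σ)
    (PosSemidef.one.kronecker hσ.posSemidef)
  rw [tensorMap_kronecker, LinearMap.id_apply] at h_ampliation
  simpa only [partialTraceLeft_kronecker, trace_one, Fintype.card_fin, Nat.cast_one, one_smul]
    using posSemidef_partialTraceLeft h_ampliation

theorem IsEntanglementBreaking.preservesStates [DecidableEq a]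
    {Φ : Matrix a a ℂ →ₗ[ℂ] Matrix b b ℂ} (hΦ : IsEntanglementBreaking Φ) :
    PreservesStates Φ := by
  obtain ⟨K, R, X, hR, hX, hX_sum, hΦ⟩ := hΦ
  intro ρ hρ
  simp only [hΦ, ← re_smul_eq_smul (trace_mul_nonneg (hX _) hρ.posSemidef)]
  exact isDensityMatrix_sum_smul (re_trace_mul_mem_stdSimplex hX hX_sum hρ) hR

theorem IsEntanglementBreaking.exists_ensemble {d : Type*} [DecidableEq a] [DecidableEq c]
    [Nonempty c] {Φ : Matrix a a ℂ →ₗ[ℂ] Matrix b b ℂ} (hΦ : IsEntanglementBreaking Φ)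
    (Ω : Matrix c c ℂ →ₗ[ℂ] Matrix d d ℂ) {ρ : Matrix (a × c) (a × c) ℂ}
    (hρ : IsDensityMatrix ρ) :
    ∃ (K : ℕ) (p : Fin K → ℝ) (R : Fin K → Matrix b b ℂ) (σ : Fin K → Matrix c c ℂ),
      p ∈ stdSimplex ℝ (Fin K) ∧ (∀ k, IsDensityMatrix (R k)) ∧ (∀ k, IsDensityMatrix (σ k)) ∧
      Φ (partialTraceRight ρ) = ∑ k, p k • R k ∧
      tensorMap Φ Ω ρ = ∑ k, p k • (R k ⊗ₖ Ω (σ k)) := by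
  obtain ⟨K, R, X, hR, hX, hX_sum, hΦ⟩ := hΦ
  have h_prob (k : Fin K) :
      (partialTraceLeft ((X k ⊗ₖ (1 : Matrix c c ℂ)) * ρ)).trace =
        (X k * partialTraceRight ρ).trace := by
    rw [trace_partialTraceLeft, ← trace_partialTraceRight, partialTraceRight_kronecker_one_mul]
  choose σ hσ hσ_smul using fun k => exists_isDensityMatrix_re_trace_smul_eq
    (posSemidef_partialTraceLeft_kronecker_one_mul (hX k) hρ.posSemidef)
  refine ⟨K, fun k => (X k * partialTraceRight ρ).trace.re, R, σ,
    re_trace_mul_mem_stdSimplex hX hX_sum hρ.partialTraceRight, hR, hσ, ?_, ?_⟩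
  · simp only [hΦ, re_smul_eq_smul (trace_mul_nonneg (hX _) hρ.partialTraceRight.posSemidef)]
  · rw [tensorMap_eq_sum_kronecker hΦ]
    refine Finset.sum_congr rfl fun k _ => ?_
    rw [← hσ_smul k, LinearMap.map_smul_of_tower, kronecker_smul, h_prob]

theorem IsEntanglementBreaking.preservesStates_tensorMap [DecidableEq a] [DecidableEq c]
    [Nonempty c] {Φ : Matrix a a ℂ →ₗ[ℂ] Matrix b b ℂ} (hΦ : IsEntanglementBreaking Φ)
    {Ω : Matrix c c ℂ →ₗ[ℂ] Matrix d d ℂ} (hΩ : PreservesStates Ω) :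
    PreservesStates (tensorMap Φ Ω) := by
  intro ρ hρ
  obtain ⟨K, p, R, σ, hp, hR, hσ, -, h_tensor⟩ := hΦ.exists_ensemble Ω hρ
  rw [h_tensor]
  exact isDensityMatrix_sum_smul hp fun k => (hR k).kronecker (hΩ _ (hσ k))

end Channels

section MinEntropy

variable {a b c d : Type*} [Fintype a] [Fintype b] [DecidableEq b] [Fintype c] [Fintype d]
  [DecidableEq d] {Φ : Matrix a a ℂ →ₗ[ℂ] Matrix b b ℂ} {Ω : Matrix c c ℂ →ₗ[ℂ] Matrix d d ℂ}

theorem minEntropy_le (hΦ : PreservesStates Φ) {ρ : Matrix a a ℂ} (hρ : IsDensityMatrix ρ) :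
    minEntropy Φ ≤ vonNeumannEntropy (Φ ρ) := by
  refine csInf_le ⟨0, ?_⟩ ⟨ρ, hρ, rfl⟩
  rintro _ ⟨σ, hσ, rfl⟩
  exact vonNeumannEntropy_nonneg (hΦ σ hσ)

theorem le_minEntropy [Nonempty a] {s : ℝ}
    (h : ∀ ρ, IsDensityMatrix ρ → s ≤ vonNeumannEntropy (Φ ρ)) : s ≤ minEntropy Φ := by
  obtain ⟨ρ, hρ⟩ := exists_isDensityMatrix a
  refine le_csInf ⟨_, ρ, hρ, rfl⟩ ?_
  rintro _ ⟨σ, hσ, rfl⟩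
  exact h σ hσ

variable [DecidableEq a] [Nonempty a] [DecidableEq c] [Nonempty c]

theorem minEntropy_tensorMap_le (hΦ : PreservesStates Φ) (hΩ : PreservesStates Ω)
    (hΦΩ : PreservesStates (tensorMap Φ Ω)) :
    minEntropy (tensorMap Φ Ω) ≤ minEntropy Φ + minEntropy Ω := by
  rw [← sub_le_iff_le_add]
  refine le_minEntropy fun ρ hρ => ?_
  rw [sub_le_comm]
  refine le_minEntropy fun σ hσ => ?_
  rw [sub_le_iff_le_add']
  calc minEntropy (tensorMap Φ Ω) ≤ vonNeumannEntropy (tensorMap Φ Ω (ρ ⊗ₖ σ)) :=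
        minEntropy_le hΦΩ (hρ.kronecker hσ)
    _ = vonNeumannEntropy (Φ ρ) + vonNeumannEntropy (Ω σ) := by
        rw [tensorMap_kronecker, vonNeumannEntropy_kronecker (hΦ ρ hρ) (hΩ σ hσ)]

theorem IsEntanglementBreaking.add_minEntropy_le (hΦ : IsEntanglementBreaking Φ)
    (hΩ : PreservesStates Ω) : minEntropy Φ + minEntropy Ω ≤ minEntropy (tensorMap Φ Ω) := by
  refine le_minEntropy fun ρ hρ => ?_
  obtain ⟨K, p, R, σ, hp, hR, hσ, h_marginal, h_tensor⟩ := hΦ.exists_ensemble Ω hρ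
  have h_left : minEntropy Φ ≤ vonNeumannEntropy (∑ k, p k • R k) :=
    h_marginal ▸ minEntropy_le hΦ.preservesStates hρ.partialTraceRight
  have h_right : minEntropy Ω ≤ ∑ k, p k * vonNeumannEntropy (Ω (σ k)) :=
    calc minEntropy Ω = ∑ k, p k * minEntropy Ω := by rw [← Finset.sum_mul, hp.2, one_mul]
      _ ≤ ∑ k, p k * vonNeumannEntropy (Ω (σ k)) := Finset.sum_le_sum fun k _ =>
        mul_le_mul_of_nonneg_left (minEntropy_le hΩ (hσ k)) (hp.1 k)
  calc minEntropy Φ + minEntropy Ω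
      ≤ vonNeumannEntropy (∑ k, p k • R k) + ∑ k, p k * vonNeumannEntropy (Ω (σ k)) :=
        add_le_add h_left h_right
    _ ≤ vonNeumannEntropy (∑ k, p k • (R k ⊗ₖ Ω (σ k))) :=
        vonNeumannEntropy_sum_smul_add_le hp.1 hR fun k => hΩ _ (hσ k)
    _ = vonNeumannEntropy (tensorMap Φ Ω ρ) := by rw [h_tensor]

end MinEntropy

end QChan

theorem mainTheorem4_general {a b c d : Type*}
    [Fintype a] [DecidableEq a] [Nonempty a] [Fintype b] [DecidableEq b]
    [Fintype c] [DecidableEq c] [Nonempty c] [Fintype d] [DecidableEq d]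
    (Φ : Matrix a a ℂ →ₗ[ℂ] Matrix b b ℂ) (Ω : Matrix c c ℂ →ₗ[ℂ] Matrix d d ℂ)
    (hΦ : QChan.IsEntanglementBreaking Φ) (hΩ : QChan.PreservesStates Ω) :
    QChan.minEntropy (QChan.tensorMap Φ Ω) = QChan.minEntropy Φ + QChan.minEntropy Ω :=
  le_antisymm
    (QChan.minEntropy_tensorMap_le hΦ.preservesStates hΩ (hΦ.preservesStates_tensorMap hΩ))
    (hΦ.add_minEntropy_le hΩ)

theorem mainTheorem4 {a b c d : Type*}
    [Fintype a] [DecidableEq a] [Nonempty a] [Fintype b] [DecidableEq b]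
    [Fintype c] [DecidableEq c] [Nonempty c] [Fintype d] [DecidableEq d]
    (Φ : Matrix a a ℂ →ₗ[ℂ] Matrix b b ℂ) (Ω : Matrix c c ℂ →ₗ[ℂ] Matrix d d ℂ)
    (hΦ : QChan.IsEntanglementBreaking Φ) (hΩ : QChan.IsChannel Ω) :
    QChan.minEntropy (QChan.tensorMap Φ Ω) = QChan.minEntropy Φ + QChan.minEntropy Ω :=
  mainTheorem4_general Φ Ω hΦ hΩ.preservesStates
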